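/- **Setting.** Parametrize an open dense part of the round unit sphere $S^4\subset\mathbb R^3\oplus\mathbb R^2$ by $(\cos\alpha\,\mathbf u,\sin\alpha\,\mathbf v)$, with $\mathbf u=(\cos\theta,\sin\theta\cos\phi,\sin\theta\sin\phi)$, $\mathbf v=(\cos\beta,\sin\beta)$, $\alpha\in(0,\pi/2)$, $\theta\in(0,\pi)$ ($\beta,\phi$ are angles). Let $f_0=\partial_\alpha$, $f_1=\frac{\partial_\beta}{\sin\alpha}$, $f_2=\frac{\partial_\theta}{\cos\alpha}$, $f_3=\frac{\partial_\phi}{\cos\alpha\sin\theta}$, let $b_0,\dots,b_3$ be the dual orthonormal coframe, let $\omega^i_j=\langle f_i,\nabla f_j\rangle$ be the Levi-Civita connection forms, and put $2\rho_1=\omega^3_2-\omega^1_0$, $2\rho_2=-\omega^2_0-\omega^3_1$, $2\rho_3=\omega^2_1-\omega^3_0$. Let $(a_0,a_1,a_2,a_3)$ be the linear fibre coordinates on the negative spinor bundle of $S^4$ in the local spin trivialization given by this frame, with $r^2=\sum_i a_i^2$ and vertical 1-forms $$\begin{aligned}\xi_0&=da_0+\rho_1a_1+\rho_2a_2+\rho_3a_3,&\xi_1&=da_1-\rho_1a_0-\rho_3a_2+\rho_2a_3,\\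 \xi_2&=da_2-\rho_2a_0+\rho_3a_1-\rho_1a_3,&\xi_3&=da_3-\rho_3a_0-\rho_2a_1+\rho_1a_2.\end{aligned}$$ For $c\ge 0$ the Bryant–Salamon Cayley form and its metric are $$\Phi_c=16(c+r^2)^{-4/5}\xi_0\wedge\xi_1\wedge\xi_2\wedge\xi_3+25(c+r^2)^{6/5}b_0\wedge b_1\wedge b_2\wedge b_3+20(c+r^2)^{1/5}\sum_{i=1}^3A_i\wedge\Omega_i,$$ $$g_c=4(c+r^2)^{-2/5}\sum_{i=0}^3\xi_i^2+5(c+r^2)^{3/5}\sum_{i=0}^3b_i^2,$$ where $A_i=\xi_0\wedge\xi_i-\xi_j\wedge\xi_k$ and $\Omega_i=b_0\wedge b_i-b_j\wedge b_k$ for $(i,j,k)$ a cyclic permutation of $(1,2,3)$. Let $\mathcal U$ be the chart with coordinates $(\alpha,\beta,\theta,\phi,s,t,\delta,\gamma)$, $s,t>0$, where $$a_0=s\cos\tfrac{\delta-\gamma}2,\quad a_1=s\sin\tfrac{\delta-\gamma}2,\quad a_2=t\cos\tfrac{\delta+\gamma}2,\quad a_3=t\sin\tfrac{\delta+\gamma}2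 .$$ The orbits of the $\mathrm{SU}(2)$-action lifting $\mathrm{SO}(3)\times\mathrm{Id}_2$ are parametrized in $\mathcal U$ by $(\gamma,\theta,\phi)$, with $(\alpha,\beta,s,t,\delta)$ constant. **Theorem.** Let $c\ge0$, $\varepsilon>0$, and let $\tau\mapsto(\alpha,\beta,s,t,\delta)(\tau)$, $\tau\in(-\varepsilon,\varepsilon)$, be a $C^1$ curve with nowhere vanishing derivative and with $\alpha\in(0,\pi/2)$, $s>0$, $t>0$. Let $N$ be the $\mathrm{SU}(2)$-invariant 4-fold swept out by the orbits through this curve, that is, the (immersed) 4-fold parametrized in $\mathcal U$ by $$(\tau,\gamma,\theta,\phi)\mapsto\Big(\alpha(\tau),\beta(\tau),\theta,\phi;\ s\cos\tfrac{\delta-\gamma}2,\ s\sin\tfrac{\delta-\gamma}2,\ t\cos\tfrac{\delta+\gamma}2,\ t\sin\tfrac{\delta+\gamma}2\Big),\qquad s=s(\tau),\ t=t(\tau),\ \delta=\delta(\tau),$$ with $\gamma,\phi$ arbitrary angles and $\theta\in(0,\pi)$. Then $N$ is Cayley in $\mathcal U$ with respect to $\Phi_c$, i.e. $\Phi_c|_N=\mathrm{vol}_N$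 for one of the two orientations of $N$, where $\mathrm{vol}_N$ is the volume form of the metric induced by $g_c$, if and only if, for all $\tau\in(-\varepsilon,\varepsilon)$, $$\left\{\begin{aligned} &(s^2+t^2)\sin^2\alpha\cos\alpha\,\dot\beta=0\\ &\cos^2\alpha\,(t\dot s-s\dot t)=0\\ &\cos^2\alpha\, st\,\dot\delta=0\\ &-5(c+r^2)\cos^2\alpha\, s\dot\alpha+r^2\sin^2\alpha\,\dot\alpha s-2\sin\alpha\cos\alpha\, t^2\dot s-4\cos\alpha\sin\alpha\, s^2\dot s-2\sin\alpha\cos\alpha\, st\dot t=0\\ &5(c+r^2)\cos^2\alpha\, t\dot\alpha-r^2\sin^2\alpha\,\dot\alpha t+2\sin\alpha\cos\alpha\, s^2\dot t+4\cos\alpha\sin\alpha\, t^2\dot t+2\sin\alpha\cos\alpha\, st\dot s=0\\ &5(c+r^2)\sin\alpha\cos^2\alpha\,\dot\beta s-2\sin\alpha\cos\alpha\, t^2s\dot\delta-r^2\sin^3\alpha\,\dot\beta s=0\\ &-5(c+r^2)\sin\alpha\cos^2\alpha\,\dot\beta t-2\sin\alpha\cos\alpha\, ts^2\dot\delta+r^2\sin^3\alpha\,\dot\beta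 t=0 \end{aligned}\right.$$ where $r^2=s^2+t^2$. -/

import Mathlib

open Real Set

namespace BryantSalamon

/-! ### The round 4-sphere in the coordinates `x = (α, β, θ, φ)` -/

/-- The point `(cos α · u, sin α · v)` of `S⁴ ⊆ ℝ³ ⊕ ℝ²`, where
`u = (cos θ, sin θ cos φ, sin θ sin φ)` and `v = (cos β, sin β)`. -/
noncomputable def spherePoint (x : Fin 4 → ℝ) : Fin 5 → ℝ :=
  ![cos (x 0) * cos (x 2),
    cos (x 0) * (sin (x 2) * cos (x 3)),
    cos (x 0) * (sin (x 2) * sin (x 3)),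
    sin (x 0) * cos (x 1),
    sin (x 0) * sin (x 1)]

/-- The orthonormal frame `f₀ = ∂_α`, `f₁ = ∂_β / sin α`, `f₂ = ∂_θ / cos α`,
`f₃ = ∂_φ / (cos α sin θ)` of `S⁴`, as vectors of `ℝ⁵`. -/
noncomputable def sphereFrame (i : Fin 4) (x : Fin 4 → ℝ) : Fin 5 → ℝ :=
  (![![-(sin (x 0) * cos (x 2)), -(sin (x 0) * (sin (x 2) * cos (x 3))),
        -(sin (x 0) * (sin (x 2) * sin (x 3))), cos (x 0) * cos (x 1), cos (x 0) * sin (x 1)],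
     ![0, 0, 0, -sin (x 1), cos (x 1)],
     ![-sin (x 2), cos (x 2) * cos (x 3), cos (x 2) * sin (x 3), 0, 0],
     ![0, -sin (x 3), cos (x 3), 0, 0]] : Fin 4 → Fin 5 → ℝ) i

/-- The dual orthonormal coframe: `b_i(X) = ⟨f_i, X⟩`, for `X` a coordinate vector pushed forward
to `ℝ⁵`. Thus `b₀ = dα`, `b₁ = sin α dβ`, `b₂ = cos α dθ`, `b₃ = cos α sin θ dφ`. -/
noncomputable def sphereCoframe (x : Fin 4 → ℝ) (i : Fin 4) : (Fin 4 → ℝ) →ₗ[ℝ] ℝ where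
  toFun X := sphereFrame i x ⬝ᵥ fderiv ℝ spherePoint x X
  map_add' X Y := by simp [dotProduct_add]
  map_smul' r X := by simp [dotProduct_smul]

/-- The Levi-Civita connection forms `ω^i_j(X) = ⟨f_i, ∇_X f_j⟩`. Since `S⁴ ⊆ ℝ⁵` carries the
induced metric, `∇` is the tangential part of the derivative in `ℝ⁵`. -/
noncomputable def leviCivita (x : Fin 4 → ℝ) (i j : Fin 4) : (Fin 4 → ℝ) →ₗ[ℝ] ℝ where
  toFun X := sphereFrame i x ⬝ᵥ fderiv ℝ (sphereFrame j) x X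
  map_add' X Y := by simp [dotProduct_add]
  map_smul' r X := by simp [dotProduct_smul]

/-! ### The negative spinor bundle in the spin trivialization given by the frame `f` -/

/-- Coordinates on the negative spinor bundle of `S⁴`: a pair `(x, a)` of
`x = (α, β, θ, φ)` and the linear fibre coordinates `a = (a₀, a₁, a₂, a₃)`. The coordinate
vectors at each point are elements of the same space. -/
abbrev Chart : Type := (Fin 4 → ℝ) × (Fin 4 → ℝ)

/-- The pullback of a covector of the base to the spinor bundle. -/
noncomputable def pull (η : (Fin 4 → ℝ) →ₗ[ℝ] ℝ) : Chart →ₗ[ℝ] ℝ :=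
  η ∘ₗ LinearMap.fst ℝ (Fin 4 → ℝ) (Fin 4 → ℝ)

/-- The horizontal 1-forms `b₀, b₁, b₂, b₃` on the spinor bundle. -/
noncomputable def b (m : Chart) (i : Fin 4) : Chart →ₗ[ℝ] ℝ := pull (sphereCoframe m.1 i)

/-- `2ρ₁ = ω³₂ - ω¹₀`. -/
noncomputable def rho₁ (m : Chart) : Chart →ₗ[ℝ] ℝ :=
  (1 / 2 : ℝ) • pull (leviCivita m.1 3 2 - leviCivita m.1 1 0)

/-- `2ρ₂ = -ω²₀ - ω³₁`. -/
noncomputable def rho₂ (m : Chart) : Chart →ₗ[ℝ] ℝ :=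
  (1 / 2 : ℝ) • pull (-leviCivita m.1 2 0 - leviCivita m.1 3 1)

/-- `2ρ₃ = ω²₁ - ω³₀`. -/
noncomputable def rho₃ (m : Chart) : Chart →ₗ[ℝ] ℝ :=
  (1 / 2 : ℝ) • pull (leviCivita m.1 2 1 - leviCivita m.1 3 0)

/-- The 1-form `da_i`. -/
noncomputable def da (i : Fin 4) : Chart →ₗ[ℝ] ℝ :=
  LinearMap.proj i ∘ₗ LinearMap.snd ℝ (Fin 4 → ℝ) (Fin 4 → ℝ)

/-- The vertical 1-forms `ξ₀, ξ₁, ξ₂, ξ₃` of the spin connection. -/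
noncomputable def xi (m : Chart) : Fin 4 → (Chart →ₗ[ℝ] ℝ) :=
  ![da 0 + m.2 1 • rho₁ m + m.2 2 • rho₂ m + m.2 3 • rho₃ m,
    da 1 - m.2 0 • rho₁ m - m.2 2 • rho₃ m + m.2 3 • rho₂ m,
    da 2 - m.2 0 • rho₂ m + m.2 1 • rho₃ m - m.2 3 • rho₁ m,
    da 3 - m.2 0 • rho₃ m - m.2 1 • rho₂ m + m.2 2 • rho₁ m]

/-! ### The Bryant–Salamon structures -/

/-- The wedge product `ζ₀ ∧ ζ₁ ∧ ζ₂ ∧ ζ₃` of four covectors: `(v₀, …, v₃) ↦ det (ζ_j(v_i))`. -/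
noncomputable def wedge (ζ₀ ζ₁ ζ₂ ζ₃ : Chart →ₗ[ℝ] ℝ) : Chart [⋀^Fin 4]→ₗ[ℝ] ℝ :=
  Matrix.detRowAlternating.compLinearMap (LinearMap.pi ![ζ₀, ζ₁, ζ₂, ζ₃])

/-- `A_i ∧ Ω_i = (ξ₀ ∧ ξ_i - ξ_j ∧ ξ_k) ∧ (b₀ ∧ b_i - b_j ∧ b_k)`. -/
noncomputable def wedgeAΩ (m : Chart) (i j k : Fin 4) : Chart [⋀^Fin 4]→ₗ[ℝ] ℝ :=
  wedge (xi m 0) (xi m i) (b m 0) (b m i) - wedge (xi m 0) (xi m i) (b m j) (b m k)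
    - wedge (xi m j) (xi m k) (b m 0) (b m i) + wedge (xi m j) (xi m k) (b m j) (b m k)

/-- `c + r²`, with `r² = a₀² + a₁² + a₂² + a₃²`. -/
noncomputable def cr (c : ℝ) (m : Chart) : ℝ := c + ∑ i, m.2 i ^ 2

/-- The Cayley form `Φ_c` at the point `m`. -/
noncomputable def Phi (c : ℝ) (m : Chart) : Chart [⋀^Fin 4]→ₗ[ℝ] ℝ :=
  (16 * cr c m ^ (-4 / 5 : ℝ)) • wedge (xi m 0) (xi m 1) (xi m 2) (xi m 3)
    + (25 * cr c m ^ (6 / 5 : ℝ)) • wedge (b m 0) (b m 1) (b m 2) (b m 3)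
    + (20 * cr c m ^ (1 / 5 : ℝ)) • (wedgeAΩ m 1 2 3 + wedgeAΩ m 2 3 1 + wedgeAΩ m 3 1 2)

/-- The Riemannian metric `g_c` at the point `m`. -/
noncomputable def metric (c : ℝ) (m : Chart) (V W : Chart) : ℝ :=
  4 * cr c m ^ (-2 / 5 : ℝ) * ∑ i, xi m i V * xi m i W
    + 5 * cr c m ^ (3 / 5 : ℝ) * ∑ i, b m i V * b m i W

/-! ### Cayley submanifolds -/

/-- The coordinate tangent vectors `∂₀F, ∂₁F, ∂₂F, ∂₃F` of a map `F` of four parameters. -/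
noncomputable def tangent (F : (Fin 4 → ℝ) → Chart) (p : Fin 4 → ℝ) (i : Fin 4) : Chart :=
  fderiv ℝ F p (Pi.single i 1)

/-- The Riemannian volume `√det (g_c(∂_iF, ∂_jF))` of the coordinate tangent vectors. -/
noncomputable def volume (c : ℝ) (F : (Fin 4 → ℝ) → Chart) (p : Fin 4 → ℝ) : ℝ :=
  √(Matrix.det (Matrix.of fun i j => metric c (F p) (tangent F p i) (tangent F p j)))

/-- The 4-fold `F(D)`, parametrized by a connected open set `D`, is an (immersed) Cayley
submanifold for one of its two orientations: the differential of `F` is injective on `D`, and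
`Φ_c` restricts to the volume form of the orientation given by the parameters (sign `1`)
or of the opposite one (sign `-1`). -/
def IsCayley (c : ℝ) (F : (Fin 4 → ℝ) → Chart) (D : Set (Fin 4 → ℝ)) : Prop :=
  (∀ p ∈ D, LinearIndependent ℝ (tangent F p)) ∧
    ∃ sign : ℝ, (sign = 1 ∨ sign = -1) ∧
      ∀ p ∈ D, Phi c (F p) (tangent F p) = sign * volume c F p

/-! ### The invariant 4-folds and the system of ODEs -/

/-- The parametrization, by `p = (τ, γ, θ, φ)`, of the union of the `SU(2)`-orbits through the
points of a curve `(α, β, s, t, δ)(τ)`: `γ, θ, φ` are the coordinates on the orbits. -/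
noncomputable def sweep (α β s t δ : ℝ → ℝ) (p : Fin 4 → ℝ) : Chart :=
  (![α (p 0), β (p 0), p 2, p 3],
   ![s (p 0) * cos ((δ (p 0) - p 1) / 2), s (p 0) * sin ((δ (p 0) - p 1) / 2),
     t (p 0) * cos ((δ (p 0) + p 1) / 2), t (p 0) * sin ((δ (p 0) + p 1) / 2)])

/-- The parameters `(τ, γ, θ, φ)` with `τ ∈ (-ε, ε)` and `θ ∈ (0, π)`; the angles `γ` and `φ`
run over `ℝ`. -/
def sweepDomain (ε : ℝ) : Set (Fin 4 → ℝ) :=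
  {p | p 0 ∈ Ioo (-ε) ε ∧ p 2 ∈ Ioo 0 π}

/-- The seven equations at one time; primed letters are the derivatives in `τ`. -/
def CayleyEquations (c α s t α' β' s' t' δ' : ℝ) : Prop :=
  (s ^ 2 + t ^ 2) * sin α ^ 2 * cos α * β' = 0 ∧
  cos α ^ 2 * (t * s' - s * t') = 0 ∧
  cos α ^ 2 * s * t * δ' = 0 ∧
  -5 * (c + (s ^ 2 + t ^ 2)) * cos α ^ 2 * s * α' + (s ^ 2 + t ^ 2) * sin α ^ 2 * α' * s
    - 2 * sin α * cos α * t ^ 2 * s' - 4 * cos α * sin α * s ^ 2 * s'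
    - 2 * sin α * cos α * s * t * t' = 0 ∧
  5 * (c + (s ^ 2 + t ^ 2)) * cos α ^ 2 * t * α' - (s ^ 2 + t ^ 2) * sin α ^ 2 * α' * t
    + 2 * sin α * cos α * s ^ 2 * t' + 4 * cos α * sin α * t ^ 2 * t'
    + 2 * sin α * cos α * s * t * s' = 0 ∧
  5 * (c + (s ^ 2 + t ^ 2)) * sin α * cos α ^ 2 * β' * s - 2 * sin α * cos α * t ^ 2 * s * δ'
    - (s ^ 2 + t ^ 2) * sin α ^ 3 * β' * s = 0 ∧
  -5 * (c + (s ^ 2 + t ^ 2)) * sin α * cos α ^ 2 * β' * t - 2 * sin α * cos α * t * s ^ 2 * δ'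
    + (s ^ 2 + t ^ 2) * sin α ^ 3 * β' * t = 0

end BryantSalamon

/-!
Write `u = cos α`, `v = sin α`, `r² = s² + t²`, `w = (c + r²) ^ (1/5)`. The tangent space of the
4-fold has an adapted frame, `∂_τ + cos α β' ∂_γ` together with the vectors dual to the
left-invariant forms on the orbit (`frameChange`), of determinant `1 / sin θ` over the coordinate
vectors. On it the forms `ξ₀ + i ξ₁`, `ξ₂ + i ξ₃`, `b₂ + i b₃` take values that depend on
`γ` only through phases (`xi_frame`, `b_frame`), and neither `Φ_c` nor `g_c` sees these phases.
So both sides of the Cayley condition are `sin θ` times functions of `τ`.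

The three orbit directions are orthogonal, and the Gram determinant can be written down
(`gram_frame`, `det_arrow`). It equals the square of `Φ_c` plus a defect
(`det_gram_eq_phiValue_sq_add_defect`), which is a combination with positive coefficients of the
squares of `(5 (c + r²) u² - r² v²) α' + 4 u v (s s' + t t')`, `t s' - s t'`, `β'` and `δ'`. Where
`Φ_c = ± vol`, the defect vanishes, hence all four quantities do (`defect_eq_zero_iff`), and they
generate the same linear system as the seven equations (`cayleyEquations_iff`).

Conversely, the equations give `Φ_c² = vol²` at each point. As the curve is regular, `Φ_c` has no
zero on the tangent spaces (`phiValue_ne_zero`), so these are 4-dimensional, and by continuity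
along the interval `Φ_c` keeps one sign.
-/

namespace BryantSalamon

/-! ### The forms `b`, `ξ` in coordinates, and the differential of the parametrization -/

theorem fderiv_apply_eq_of_hasDerivAt_line {n : ℕ} {f : (Fin 4 → ℝ) → Fin n → ℝ}
    {x X : Fin 4 → ℝ} {D : Fin n → ℝ} (hf : DifferentiableAt ℝ f x)
    (h : ∀ i, HasDerivAt (fun r : ℝ => f (x + r • X) i) (D i) 0) : fderiv ℝ f x X = D := by
  have hl : HasDerivAt (fun r : ℝ => x + r • X) X 0 := by
    simpa using ((hasDerivAt_id (0 : ℝ)).smul_const X).const_add x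
  have hf' : HasFDerivAt f (fderiv ℝ f x) (x + (0 : ℝ) • X) := by simpa using hf.hasFDerivAt
  exact (hf'.comp_hasDerivAt (0 : ℝ) hl).unique (hasDerivAt_pi.2 h)

theorem hasDerivAt_line_apply (x X : Fin 4 → ℝ) (i : Fin 4) :
    HasDerivAt (fun r : ℝ => (x + r • X) i) (X i) 0 := by
  simpa using ((hasDerivAt_id (0 : ℝ)).mul_const (X i)).const_add (x i)

theorem fderiv_spherePoint (x X : Fin 4 → ℝ) :
    fderiv ℝ spherePoint x X =
      ![-(sin (x 0) * X 0) * cos (x 2) - cos (x 0) * (sin (x 2) * X 2),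
        -(sin (x 0) * X 0) * (sin (x 2) * cos (x 3)) +
          cos (x 0) * (cos (x 2) * X 2 * cos (x 3) - sin (x 2) * (sin (x 3) * X 3)),
        -(sin (x 0) * X 0) * (sin (x 2) * sin (x 3)) +
          cos (x 0) * (cos (x 2) * X 2 * sin (x 3) + sin (x 2) * (cos (x 3) * X 3)),
        cos (x 0) * X 0 * cos (x 1) - sin (x 0) * (sin (x 1) * X 1),
        cos (x 0) * X 0 * sin (x 1) + sin (x 0) * (cos (x 1) * X 1)] := by
  have h := hasDerivAt_line_apply x X
  apply fderiv_apply_eq_of_hasDerivAt_line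
  · refine differentiableAt_pi.2 fun i => ?_
    fin_cases i <;> simp [spherePoint] <;> fun_prop
  intro i
  fin_cases i
  · exact ((h 0).cos.mul (h 2).cos).congr_deriv (by simp; ring)
  · exact ((h 0).cos.mul ((h 2).sin.mul (h 3).cos)).congr_deriv (by simp [sub_eq_add_neg])
  · exact ((h 0).cos.mul ((h 2).sin.mul (h 3).sin)).congr_deriv (by simp)
  · exact ((h 0).sin.mul (h 1).cos).congr_deriv (by simp [sub_eq_add_neg])
  · exact ((h 0).sin.mul (h 1).sin).congr_deriv (by simp)

/-- The coframe is `b₀ = dα`, `b₁ = sin α dβ`, `b₂ = cos α dθ`, `b₃ = cos α sin θ dφ`. -/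
theorem sphereCoframe_apply (x X : Fin 4 → ℝ) (i : Fin 4) :
    sphereCoframe x i X =
      ![X 0, sin (x 0) * X 1, cos (x 0) * X 2, cos (x 0) * sin (x 2) * X 3] i := by
  have h0 := sin_sq_add_cos_sq (x 0)
  have h1 := sin_sq_add_cos_sq (x 1)
  have h2 := sin_sq_add_cos_sq (x 2)
  have h3 := sin_sq_add_cos_sq (x 3)
  change sphereFrame i x ⬝ᵥ fderiv ℝ spherePoint x X = _
  rw [fderiv_spherePoint]
  fin_cases i <;>
    simp only [sphereFrame, dotProduct, Fin.sum_univ_five, Fin.isValue, Fin.zero_eta, Fin.mk_one,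
      Fin.reduceFinMk, Matrix.cons_val]
  · grind
  · grind
  · grind
  · grind

theorem fderiv_sphereFrame_zero (x X : Fin 4 → ℝ) :
    fderiv ℝ (sphereFrame 0) x X =
      ![-(cos (x 0) * X 0 * cos (x 2) - sin (x 0) * (sin (x 2) * X 2)),
        -(cos (x 0) * X 0 * (sin (x 2) * cos (x 3)) +
          sin (x 0) * (cos (x 2) * X 2 * cos (x 3) - sin (x 2) * (sin (x 3) * X 3))),
        -(cos (x 0) * X 0 * (sin (x 2) * sin (x 3)) +
          sin (x 0) * (cos (x 2) * X 2 * sin (x 3) + sin (x 2) * (cos (x 3) * X 3))),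
        -(sin (x 0) * X 0) * cos (x 1) - cos (x 0) * (sin (x 1) * X 1),
        -(sin (x 0) * X 0) * sin (x 1) + cos (x 0) * (cos (x 1) * X 1)] := by
  have h := hasDerivAt_line_apply x X
  apply fderiv_apply_eq_of_hasDerivAt_line
  · refine differentiableAt_pi.2 fun i => ?_
    fin_cases i <;> simp [sphereFrame] <;> fun_prop
  intro i
  fin_cases i
  · exact ((h 0).sin.mul (h 2).cos).neg.congr_deriv (by simp; ring)
  · exact ((h 0).sin.mul ((h 2).sin.mul (h 3).cos)).neg.congr_deriv (by simp [sub_eq_add_neg])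
  · exact ((h 0).sin.mul ((h 2).sin.mul (h 3).sin)).neg.congr_deriv (by simp)
  · exact ((h 0).cos.mul (h 1).cos).congr_deriv (by simp [sub_eq_add_neg])
  · exact ((h 0).cos.mul (h 1).sin).congr_deriv (by simp)

theorem fderiv_sphereFrame_one (x X : Fin 4 → ℝ) :
    fderiv ℝ (sphereFrame 1) x X =
      ![0, 0, 0, -(cos (x 1) * X 1), -(sin (x 1) * X 1)] := by
  have h := hasDerivAt_line_apply x X
  apply fderiv_apply_eq_of_hasDerivAt_line
  · refine differentiableAt_pi.2 fun i => ?_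
    fin_cases i <;> simp [sphereFrame] <;> fun_prop
  intro i
  fin_cases i
  iterate 3 exact hasDerivAt_const _ _
  · exact (h 1).sin.neg.congr_deriv (by simp)
  · exact (h 1).cos.congr_deriv (by simp)

theorem fderiv_sphereFrame_two (x X : Fin 4 → ℝ) :
    fderiv ℝ (sphereFrame 2) x X =
      ![-(cos (x 2) * X 2),
        -(sin (x 2) * X 2) * cos (x 3) - cos (x 2) * (sin (x 3) * X 3),
        -(sin (x 2) * X 2) * sin (x 3) + cos (x 2) * (cos (x 3) * X 3), 0, 0] := by
  have h := hasDerivAt_line_apply x X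
  apply fderiv_apply_eq_of_hasDerivAt_line
  · refine differentiableAt_pi.2 fun i => ?_
    fin_cases i <;> simp [sphereFrame] <;> fun_prop
  intro i
  fin_cases i
  · exact (h 2).sin.neg.congr_deriv (by simp)
  · exact ((h 2).cos.mul (h 3).cos).congr_deriv (by simp; ring)
  · exact ((h 2).cos.mul (h 3).sin).congr_deriv (by simp)
  iterate 2 exact hasDerivAt_const _ _

/-- The combination of connection forms in `rho₁`. -/
theorem leviCivita_sub_one (x X : Fin 4 → ℝ) :
    (leviCivita x 3 2 - leviCivita x 1 0) X = cos (x 2) * X 3 - cos (x 0) * X 1 := by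
  have h1 := sin_sq_add_cos_sq (x 1)
  have h3 := sin_sq_add_cos_sq (x 3)
  change sphereFrame 3 x ⬝ᵥ fderiv ℝ (sphereFrame 2) x X -
    sphereFrame 1 x ⬝ᵥ fderiv ℝ (sphereFrame 0) x X = _
  rw [fderiv_sphereFrame_zero, fderiv_sphereFrame_two]
  simp only [sphereFrame, dotProduct, Fin.sum_univ_five, Fin.isValue, Matrix.cons_val]
  grind

/-- The combination of connection forms in `rho₂`. -/
theorem leviCivita_sub_two (x X : Fin 4 → ℝ) :
    (-leviCivita x 2 0 - leviCivita x 3 1) X = sin (x 0) * X 2 := by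
  have h2 := sin_sq_add_cos_sq (x 2)
  have h3 := sin_sq_add_cos_sq (x 3)
  change -(sphereFrame 2 x ⬝ᵥ fderiv ℝ (sphereFrame 0) x X) -
    sphereFrame 3 x ⬝ᵥ fderiv ℝ (sphereFrame 1) x X = _
  rw [fderiv_sphereFrame_zero, fderiv_sphereFrame_one]
  simp only [sphereFrame, dotProduct, Fin.sum_univ_five, Fin.isValue, Matrix.cons_val]
  grind

/-- The combination of connection forms in `rho₃`. -/
theorem leviCivita_sub_three (x X : Fin 4 → ℝ) :
    (leviCivita x 2 1 - leviCivita x 3 0) X = sin (x 0) * sin (x 2) * X 3 := by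
  have h3 := sin_sq_add_cos_sq (x 3)
  change sphereFrame 2 x ⬝ᵥ fderiv ℝ (sphereFrame 1) x X -
    sphereFrame 3 x ⬝ᵥ fderiv ℝ (sphereFrame 0) x X = _
  rw [fderiv_sphereFrame_zero, fderiv_sphereFrame_one]
  simp only [sphereFrame, dotProduct, Fin.sum_univ_five, Fin.isValue, Matrix.cons_val]
  grind

theorem b_apply (m V : Chart) (i : Fin 4) :
    b m i V = ![V.1 0, sin (m.1 0) * V.1 1, cos (m.1 0) * V.1 2,
      cos (m.1 0) * sin (m.1 2) * V.1 3] i :=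
  sphereCoframe_apply m.1 V.1 i

theorem rho₁_apply (m V : Chart) :
    rho₁ m V = (cos (m.1 2) * V.1 3 - cos (m.1 0) * V.1 1) / 2 := by
  rw [← leviCivita_sub_one, div_eq_inv_mul, ← one_div]; rfl

theorem rho₂_apply (m V : Chart) : rho₂ m V = sin (m.1 0) * V.1 2 / 2 := by
  rw [← leviCivita_sub_two, div_eq_inv_mul, ← one_div]; rfl

theorem rho₃_apply (m V : Chart) : rho₃ m V = sin (m.1 0) * sin (m.1 2) * V.1 3 / 2 := by
  rw [← leviCivita_sub_three, div_eq_inv_mul, ← one_div]; rfl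

theorem xi_apply (m V : Chart) (i : Fin 4) :
    xi m i V =
      ![V.2 0 + m.2 1 * rho₁ m V + m.2 2 * rho₂ m V + m.2 3 * rho₃ m V,
        V.2 1 - m.2 0 * rho₁ m V - m.2 2 * rho₃ m V + m.2 3 * rho₂ m V,
        V.2 2 - m.2 0 * rho₂ m V + m.2 1 * rho₃ m V - m.2 3 * rho₁ m V,
        V.2 3 - m.2 0 * rho₃ m V - m.2 1 * rho₂ m V + m.2 2 * rho₁ m V] i := by
  fin_cases i <;> rfl

/-- The differential of the parametrization `sweep`. -/
theorem fderiv_sweep {α β s t δ : ℝ → ℝ} {p : Fin 4 → ℝ}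
    (hα : DifferentiableAt ℝ α (p 0)) (hβ : DifferentiableAt ℝ β (p 0))
    (hs : DifferentiableAt ℝ s (p 0)) (ht : DifferentiableAt ℝ t (p 0))
    (hδ : DifferentiableAt ℝ δ (p 0)) (X : Fin 4 → ℝ) :
    fderiv ℝ (sweep α β s t δ) p X =
      (![deriv α (p 0) * X 0, deriv β (p 0) * X 0, X 2, X 3],
       ![deriv s (p 0) * X 0 * cos ((δ (p 0) - p 1) / 2) -
          s (p 0) * (sin ((δ (p 0) - p 1) / 2) * ((deriv δ (p 0) * X 0 - X 1) / 2)),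
        deriv s (p 0) * X 0 * sin ((δ (p 0) - p 1) / 2) +
          s (p 0) * (cos ((δ (p 0) - p 1) / 2) * ((deriv δ (p 0) * X 0 - X 1) / 2)),
        deriv t (p 0) * X 0 * cos ((δ (p 0) + p 1) / 2) -
          t (p 0) * (sin ((δ (p 0) + p 1) / 2) * ((deriv δ (p 0) * X 0 + X 1) / 2)),
        deriv t (p 0) * X 0 * sin ((δ (p 0) + p 1) / 2) +
          t (p 0) * (cos ((δ (p 0) + p 1) / 2) * ((deriv δ (p 0) * X 0 + X 1) / 2))]) := by
  have h := hasDerivAt_line_apply p X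
  have c {f : ℝ → ℝ} (hf : DifferentiableAt ℝ f (p 0)) :
      HasDerivAt (fun r : ℝ => f ((p + r • X) 0)) (deriv f (p 0) * X 0) 0 := by
    have hf' : HasDerivAt f (deriv f (p 0)) ((p + (0 : ℝ) • X) 0) := by simpa using hf.hasDerivAt
    exact hf'.comp (0 : ℝ) (h 0)
  have d {f : ℝ → ℝ} (hf : DifferentiableAt ℝ f (p 0)) :
      DifferentiableAt ℝ (fun q : Fin 4 → ℝ => f (q 0)) p :=
    DifferentiableAt.comp p (f := fun q : Fin 4 → ℝ => q 0) hf (differentiableAt_apply 0 p)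
  have d0 := d hα
  have d1 := d hβ
  have d2 := d hs
  have d3 := d ht
  have d4 := d hδ
  have e1 : DifferentiableAt ℝ (fun q => (sweep α β s t δ q).1) p := by
    refine differentiableAt_pi.2 fun i => ?_
    fin_cases i <;> simp [sweep] <;> first | assumption | fun_prop
  have e2 : DifferentiableAt ℝ (fun q => (sweep α β s t δ q).2) p := by
    refine differentiableAt_pi.2 fun i => ?_
    fin_cases i <;> simp [sweep] <;> fun_prop
  have key : fderiv ℝ (sweep α β s t δ) p = _ := e1.fderiv_prodMk e2
  rw [key]
  refine Prod.ext ?_ ?_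
  · refine fderiv_apply_eq_of_hasDerivAt_line e1 fun i => ?_
    fin_cases i
    · exact c hα
    · exact c hβ
    · exact h 2
    · exact h 3
  · refine fderiv_apply_eq_of_hasDerivAt_line e2 fun i => ?_
    have m := ((c hδ).sub (h 1)).div_const 2
    have n := ((c hδ).add (h 1)).div_const 2
    fin_cases i
    · exact ((c hs).mul m.cos).congr_deriv (by simp; ring)
    · exact ((c hs).mul m.sin).congr_deriv (by simp)
    · exact ((c ht).mul n.cos).congr_deriv (by simp; ring)
    · exact ((c ht).mul n.sin).congr_deriv (by simp)

/-! ### Alternating forms and Gram matrices under a change of frame -/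

theorem map_linearCombination_eq_det_mul {E : Type*} [AddCommGroup E] [Module ℝ E]
    (f : E [⋀^Fin 4]→ₗ[ℝ] ℝ) (P : Matrix (Fin 4) (Fin 4) ℝ) (V : Fin 4 → E) :
    f (fun j => ∑ i, P j i • V i) = P.det * f V := by
  have h := congrArg (fun g => g P)
    ((f.compLinearMap (Fintype.linearCombination ℝ V)).eq_smul_basis_det
      (Pi.basisFun ℝ (Fin 4)))
  have hV : (fun i => (Fintype.linearCombination ℝ V) (Pi.basisFun ℝ (Fin 4) i)) = V := by
    ext1 i
    simp
  have hP : (Pi.basisFun ℝ (Fin 4)).det P = P.det := Pi.basisFun_det_apply P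
  rw [mul_comm, ← hP, ← congrArg f hV]
  exact h

/-- The Gram matrix of `g_c` at `m` on four tangent vectors. -/
noncomputable def gram (c : ℝ) (m : Chart) (V : Fin 4 → Chart) : Matrix (Fin 4) (Fin 4) ℝ :=
  Matrix.of fun i j => metric c m (V i) (V j)

theorem gram_eq (c : ℝ) (m : Chart) (V : Fin 4 → Chart) :
    gram c m V = (4 * cr c m ^ (-2 / 5 : ℝ)) •
        ((Matrix.of fun i k => xi m k (V i)) * (Matrix.of fun i k => xi m k (V i)).transpose) +
      (5 * cr c m ^ (3 / 5 : ℝ)) •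
        ((Matrix.of fun i k => b m k (V i)) * (Matrix.of fun i k => b m k (V i)).transpose) := by
  ext i j
  simp [gram, metric, Matrix.mul_apply]

theorem det_gram_linearCombination (c : ℝ) (m : Chart) (P : Matrix (Fin 4) (Fin 4) ℝ)
    (V : Fin 4 → Chart) :
    (gram c m fun j => ∑ i, P j i • V i).det = P.det ^ 2 * (gram c m V).det := by
  have h (ζ : Fin 4 → Chart →ₗ[ℝ] ℝ) :
      (Matrix.of fun j k => ζ k (∑ i, P j i • V i)) = P * Matrix.of fun i k => ζ k (V i) := by
    ext j k
    simp [Matrix.mul_apply]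
  have e : (gram c m fun j => ∑ i, P j i • V i) = P * gram c m V * P.transpose := by
    rw [gram_eq, gram_eq, h (xi m), h (b m)]
    simp only [Matrix.transpose_mul, Matrix.mul_add, Matrix.add_mul, Matrix.mul_smul,
      Matrix.smul_mul, Matrix.mul_assoc]
  rw [e, Matrix.det_mul, Matrix.det_mul, Matrix.det_transpose]
  ring

/-- Laplace expansion of a fourfold wedge product into two twofold ones. -/
theorem wedge_apply (ζ₀ ζ₁ ζ₂ ζ₃ : Chart →ₗ[ℝ] ℝ) (V : Fin 4 → Chart) :
    wedge ζ₀ ζ₁ ζ₂ ζ₃ V =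
      (ζ₀ (V 0) * ζ₁ (V 1) - ζ₀ (V 1) * ζ₁ (V 0)) * (ζ₂ (V 2) * ζ₃ (V 3) - ζ₂ (V 3) * ζ₃ (V 2))
      - (ζ₀ (V 0) * ζ₁ (V 2) - ζ₀ (V 2) * ζ₁ (V 0)) * (ζ₂ (V 1) * ζ₃ (V 3) - ζ₂ (V 3) * ζ₃ (V 1))
      + (ζ₀ (V 0) * ζ₁ (V 3) - ζ₀ (V 3) * ζ₁ (V 0)) * (ζ₂ (V 1) * ζ₃ (V 2) - ζ₂ (V 2) * ζ₃ (V 1))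
      + (ζ₀ (V 1) * ζ₁ (V 2) - ζ₀ (V 2) * ζ₁ (V 1)) * (ζ₂ (V 0) * ζ₃ (V 3) - ζ₂ (V 3) * ζ₃ (V 0))
      - (ζ₀ (V 1) * ζ₁ (V 3) - ζ₀ (V 3) * ζ₁ (V 1)) * (ζ₂ (V 0) * ζ₃ (V 2) - ζ₂ (V 2) * ζ₃ (V 0))
      + (ζ₀ (V 2) * ζ₁ (V 3) - ζ₀ (V 3) * ζ₁ (V 2)) *
          (ζ₂ (V 0) * ζ₃ (V 1) - ζ₂ (V 1) * ζ₃ (V 0)) := by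
  change Matrix.det (Matrix.of fun i j => (![ζ₀, ζ₁, ζ₂, ζ₃] j) (V i)) = _
  rw [Matrix.det_succ_row_zero]
  simp [Fin.sum_univ_succ, Matrix.det_fin_three, Fin.succAbove]
  ring

/-- The change of basis from the coordinate vectors `∂_τ, ∂_γ, ∂_θ, ∂_φ` to the adapted frame:
`∂_τ + k ∂_γ`, `∂_γ`, and the rotation by `γ` of `∂_θ`, `(∂_φ - cos θ ∂_γ) / sin θ`, the last three
of which are dual to the left-invariant forms of the orbit. With `k = cos α β'` the forms `ξᵢ` do
not see `β'` on the first vector. -/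
noncomputable def frameChange (k γ θ : ℝ) : Matrix (Fin 4) (Fin 4) ℝ :=
  !![1, k, 0, 0;
     0, 1, 0, 0;
     0, -(sin γ * cos θ / sin θ), cos γ, sin γ / sin θ;
     0, -(cos γ * cos θ / sin θ), -sin γ, cos γ / sin θ]

theorem det_frameChange (k γ θ : ℝ) : (frameChange k γ θ).det = (sin θ)⁻¹ := by
  rw [Matrix.det_succ_row_zero]
  simp [frameChange, Fin.sum_univ_succ, Matrix.det_fin_three, Fin.succAbove]
  linear_combination (sin θ)⁻¹ * sin_sq_add_cos_sq γ

/-- The values of `ξ₀, …, ξ₃` (columns) on the adapted frame (rows). Here `c₁ + i s₁` and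
`c₂ + i s₂` are the phases of `a₀ + i a₁` and `a₂ + i a₃`. -/
noncomputable def xiFrame (v c₁ s₁ c₂ s₂ s t s' t' δ' : ℝ) : Matrix (Fin 4) (Fin 4) ℝ :=
  !![s' * c₁ - s * δ' / 2 * s₁, s' * s₁ + s * δ' / 2 * c₁,
        t' * c₂ - t * δ' / 2 * s₂, t' * s₂ + t * δ' / 2 * c₂;
     s / 2 * s₁, -(s / 2 * c₁), -(t / 2 * s₂), t / 2 * c₂;
     t * v / 2 * c₁, t * v / 2 * s₁, -(s * v / 2 * c₂), -(s * v / 2 * s₂);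
     t * v / 2 * s₁, -(t * v / 2 * c₁), s * v / 2 * s₂, -(s * v / 2 * c₂)]

/-- The values of `b₀, …, b₃` (columns) on the adapted frame (rows). The angle `γ` is the difference
of the two phases, whence the entries of the rotation. -/
def bFrame (u v c₁ s₁ c₂ s₂ α' β' : ℝ) : Matrix (Fin 4) (Fin 4) ℝ :=
  !![α', v * β', 0, 0;
     0, 0, 0, 0;
     0, 0, u * (c₁ * c₂ + s₁ * s₂), u * (c₁ * s₂ - s₁ * c₂);
     0, 0, -(u * (c₁ * s₂ - s₁ * c₂)), u * (c₁ * c₂ + s₁ * s₂)]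

theorem b_frame {α β s t δ : ℝ → ℝ} {p : Fin 4 → ℝ}
    (hα : DifferentiableAt ℝ α (p 0)) (hβ : DifferentiableAt ℝ β (p 0))
    (hs : DifferentiableAt ℝ s (p 0)) (ht : DifferentiableAt ℝ t (p 0))
    (hδ : DifferentiableAt ℝ δ (p 0)) (hθ : sin (p 2) ≠ 0) (j k : Fin 4) :
    b (sweep α β s t δ p) k (∑ i, frameChange (cos (α (p 0)) * deriv β (p 0)) (p 1) (p 2) j i •
        tangent (sweep α β s t δ) p i) =
      bFrame (cos (α (p 0))) (sin (α (p 0))) (cos ((δ (p 0) - p 1) / 2))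
        (sin ((δ (p 0) - p 1) / 2)) (cos ((δ (p 0) + p 1) / 2)) (sin ((δ (p 0) + p 1) / 2))
        (deriv α (p 0)) (deriv β (p 0)) j k := by
  have hp : p 1 = (δ (p 0) + p 1) / 2 - (δ (p 0) - p 1) / 2 := by ring
  have hc : cos (p 1) = _ := (congrArg cos hp).trans (cos_sub _ _)
  have hsn : sin (p 1) = _ := (congrArg sin hp).trans (sin_sub _ _)
  rw [Fin.sum_univ_four]
  simp only [b_apply, tangent, fderiv_sweep hα hβ hs ht hδ, sweep]
  generalize sin ((δ (p 0) - p 1) / 2) = s₁ at *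
  generalize cos ((δ (p 0) - p 1) / 2) = c₁ at *
  generalize sin ((δ (p 0) + p 1) / 2) = s₂ at *
  generalize cos ((δ (p 0) + p 1) / 2) = c₂ at *
  fin_cases j <;> fin_cases k <;> simp [frameChange, bFrame, hc, hsn] <;> field_simp <;>
    first | ring1 | exact Or.inl trivial

theorem xi_frame {α β s t δ : ℝ → ℝ} {p : Fin 4 → ℝ}
    (hα : DifferentiableAt ℝ α (p 0)) (hβ : DifferentiableAt ℝ β (p 0))
    (hs : DifferentiableAt ℝ s (p 0)) (ht : DifferentiableAt ℝ t (p 0))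
    (hδ : DifferentiableAt ℝ δ (p 0)) (hθ : sin (p 2) ≠ 0) (j k : Fin 4) :
    xi (sweep α β s t δ p) k (∑ i, frameChange (cos (α (p 0)) * deriv β (p 0)) (p 1) (p 2) j i •
        tangent (sweep α β s t δ) p i) =
      xiFrame (sin (α (p 0))) (cos ((δ (p 0) - p 1) / 2)) (sin ((δ (p 0) - p 1) / 2))
        (cos ((δ (p 0) + p 1) / 2)) (sin ((δ (p 0) + p 1) / 2)) (s (p 0)) (t (p 0))
        (deriv s (p 0)) (deriv t (p 0)) (deriv δ (p 0)) j k := by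
  have hp : p 1 = (δ (p 0) + p 1) / 2 - (δ (p 0) - p 1) / 2 := by ring
  have hc : cos (p 1) = _ := (congrArg cos hp).trans (cos_sub _ _)
  have hsn : sin (p 1) = _ := (congrArg sin hp).trans (sin_sub _ _)
  have h₁ := sin_sq_add_cos_sq ((δ (p 0) - p 1) / 2)
  have h₂ := sin_sq_add_cos_sq ((δ (p 0) + p 1) / 2)
  rw [Fin.sum_univ_four]
  simp only [xi_apply, rho₁_apply, rho₂_apply, rho₃_apply,
    tangent, fderiv_sweep hα hβ hs ht hδ, sweep]
  generalize sin ((δ (p 0) - p 1) / 2) = s₁ at *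
  generalize cos ((δ (p 0) - p 1) / 2) = c₁ at *
  generalize sin ((δ (p 0) + p 1) / 2) = s₂ at *
  generalize cos ((δ (p 0) + p 1) / 2) = c₂ at *
  fin_cases j <;> fin_cases k <;> simp [frameChange, xiFrame, hc, hsn] <;> field_simp
  all_goals first | ring1 | grind

/-! ### The Cayley form and the volume on the adapted frame -/

/-- `Φ_c` on the adapted frame: the phases drop out, as `Φ_c` is invariant under the rotations of
the coframe that they stand for, and `b₀ ∧ b₁ ∧ b₂ ∧ b₃` vanishes because `∂_γ` is vertical. -/
theorem Phi_frame {c : ℝ} {m : Chart} {V : Fin 4 → Chart}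
    {u v c₁ s₁ c₂ s₂ s t α' β' s' t' δ' : ℝ} (h₁ : s₁ ^ 2 + c₁ ^ 2 = 1) (h₂ : s₂ ^ 2 + c₂ ^ 2 = 1)
    (hb : ∀ j k, b m k (V j) = bFrame u v c₁ s₁ c₂ s₂ α' β' j k)
    (hxi : ∀ j k, xi m k (V j) = xiFrame v c₁ s₁ c₂ s₂ s t s' t' δ' j k) :
    Phi c m V = 16 * cr c m ^ (-4 / 5 : ℝ) * -((s ^ 2 + t ^ 2) * v ^ 2 * (s * s' + t * t') / 8) +
      20 * cr c m ^ (1 / 5 : ℝ) *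
        ((u ^ 2 * (s * s' + t * t') - (s ^ 2 + t ^ 2) * u * v * α') / 2) := by
  have e₁ : wedge (xi m 0) (xi m 1) (xi m 2) (xi m 3) V =
      -((s ^ 2 + t ^ 2) * v ^ 2 * (s * s' + t * t') / 8) := by
    rw [wedge_apply]
    simp only [hxi]
    simp [xiFrame]
    -- Both phases enter only through their squared moduli, which are `1`.
    trans -((s ^ 2 + t ^ 2) * v ^ 2 * (s * s' + t * t') / 8) *
      ((s₁ ^ 2 + c₁ ^ 2) * (s₂ ^ 2 + c₂ ^ 2))
    · ring
    · rw [h₁, h₂]; ring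
  have e₂ : wedge (b m 0) (b m 1) (b m 2) (b m 3) V = 0 := by
    rw [wedge_apply]
    simp only [hb]
    simp [bFrame]
  have e₃ : wedgeAΩ m 1 2 3 V + wedgeAΩ m 2 3 1 V + wedgeAΩ m 3 1 2 V =
      (u ^ 2 * (s * s' + t * t') - (s ^ 2 + t ^ 2) * u * v * α') / 2 := by
    simp only [wedgeAΩ, AlternatingMap.add_apply, AlternatingMap.sub_apply, wedge_apply, hb, hxi]
    simp [xiFrame, bFrame]
    trans (u ^ 2 * (s * s' * (s₁ ^ 2 + c₁ ^ 2) + t * t' * (s₂ ^ 2 + c₂ ^ 2)) -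
      (s ^ 2 + t ^ 2) * u * v * α') / 2 * ((s₁ ^ 2 + c₁ ^ 2) * (s₂ ^ 2 + c₂ ^ 2))
    · ring
    · rw [h₁, h₂]; ring
  simp only [Phi, AlternatingMap.add_apply, AlternatingMap.smul_apply, smul_eq_mul, e₁, e₂, e₃]
  ring

/-- The Gram matrix of the adapted frame, for the metric `A ∑ ξᵢ² + B ∑ bᵢ²`. The last three vectors
are orthogonal to each other. -/
noncomputable def frameGram (A B u v s t α' β' s' t' δ' : ℝ) : Matrix (Fin 4) (Fin 4) ℝ :=
  !![A * (s' ^ 2 + t' ^ 2 + (s ^ 2 + t ^ 2) * δ' ^ 2 / 4) + B * (α' ^ 2 + v ^ 2 * β' ^ 2),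
      A * ((t ^ 2 - s ^ 2) * δ' / 4), A * ((t * s' - s * t') * v / 2),
        -(A * (s * t * v * δ' / 2));
     A * ((t ^ 2 - s ^ 2) * δ' / 4), A * ((s ^ 2 + t ^ 2) / 4), 0, 0;
     A * ((t * s' - s * t') * v / 2), 0, A * ((s ^ 2 + t ^ 2) * v ^ 2 / 4) + B * u ^ 2, 0;
     -(A * (s * t * v * δ' / 2)), 0, 0, A * ((s ^ 2 + t ^ 2) * v ^ 2 / 4) + B * u ^ 2]

theorem gram_frame {c : ℝ} {m : Chart} {V : Fin 4 → Chart}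
    {u v c₁ s₁ c₂ s₂ s t α' β' s' t' δ' A B : ℝ}
    (h₁ : s₁ ^ 2 + c₁ ^ 2 = 1) (h₂ : s₂ ^ 2 + c₂ ^ 2 = 1)
    (hb : ∀ j k, b m k (V j) = bFrame u v c₁ s₁ c₂ s₂ α' β' j k)
    (hxi : ∀ j k, xi m k (V j) = xiFrame v c₁ s₁ c₂ s₂ s t s' t' δ' j k)
    (hA : A = 4 * cr c m ^ (-2 / 5 : ℝ)) (hB : B = 5 * cr c m ^ (3 / 5 : ℝ)) :
    gram c m V =
      frameGram A B u v s t α' β' s' t' δ' := by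
  ext i j
  simp only [gram, Matrix.of_apply, metric, ← hA, ← hB, Fin.sum_univ_four, hb, hxi]
  fin_cases i <;> fin_cases j <;> simp [frameGram, xiFrame, bFrame] <;> grind

theorem det_arrow (a b c d p q r : ℝ) :
    (!![a, b, c, d; b, p, 0, 0; c, 0, q, 0; d, 0, 0, r] : Matrix (Fin 4) (Fin 4) ℝ).det =
      a * p * q * r - b ^ 2 * q * r - c ^ 2 * p * r - d ^ 2 * p * q := by
  rw [Matrix.det_succ_row_zero]
  simp [Fin.sum_univ_succ, Matrix.det_fin_three, Fin.succAbove]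
  ring

/-- The value of `Φ_c` on the adapted frame, where `w ^ 5 = c + r²`. -/
noncomputable def phiValue (w u v s t α' s' t' : ℝ) : ℝ :=
  (2 * (5 * w ^ 5 * u ^ 2 - (s ^ 2 + t ^ 2) * v ^ 2) * (s * s' + t * t') -
    10 * w ^ 5 * (s ^ 2 + t ^ 2) * u * v * α') / w ^ 4

/-- The amount by which the squared volume of the adapted frame exceeds the square of `Φ_c`,
where `w ^ 5 = c + r²`. -/
noncomputable def defect (w u v s t α' β' s' t' δ' : ℝ) : ℝ :=
  5 / w ^ 3 *
    ((s ^ 2 + t ^ 2) * ((5 * w ^ 5 * u ^ 2 - (s ^ 2 + t ^ 2) * v ^ 2) * α' +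
        4 * u * v * (s * s' + t * t')) ^ 2 +
      4 * u ^ 2 * (5 * w ^ 5 * u ^ 2 + (s ^ 2 + t ^ 2) * v ^ 2) * (t * s' - s * t') ^ 2 +
      (s ^ 2 + t ^ 2) * v ^ 2 * (5 * w ^ 5 * u ^ 2 + (s ^ 2 + t ^ 2) * v ^ 2) ^ 2 * β' ^ 2 +
      4 * u ^ 2 * s ^ 2 * t ^ 2 * (5 * w ^ 5 * u ^ 2 + (s ^ 2 + t ^ 2) * v ^ 2) * δ' ^ 2)

/-- The `Spin(7)` identity between the Cayley form and the volume, on the adapted frame. -/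
theorem det_gram_eq_phiValue_sq_add_defect {w : ℝ} (hw : 0 < w) (u v s t α' β' s' t' δ' : ℝ)
    {A B : ℝ} (hA : A = 4 / w ^ 2) (hB : B = 5 * w ^ 3) :
    (frameGram A B u v s t α' β' s' t' δ').det =
      phiValue w u v s t α' s' t' ^ 2 + defect w u v s t α' β' s' t' δ' := by
  rw [frameGram, det_arrow, hA, hB, phiValue, defect]
  field_simp
  ring

theorem rpow_neg_div_five {x : ℝ} (hx : 0 < x) (n : ℕ) :
    x ^ (-n / 5 : ℝ) = ((x ^ (1 / 5 : ℝ)) ^ n)⁻¹ := by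
  rw [neg_div, rpow_neg hx.le, ← rpow_natCast, ← rpow_mul hx.le]
  congr 2
  ring

theorem rpow_div_five {x : ℝ} (hx : 0 < x) (n : ℕ) :
    x ^ (n / 5 : ℝ) = (x ^ (1 / 5 : ℝ)) ^ n := by
  rw [← rpow_natCast, ← rpow_mul hx.le]
  congr 1
  ring

theorem defect_eq_zero_iff {w u v s t : ℝ} (hw : 0 < w) (hu : 0 < u) (hv : 0 < v) (hs : 0 < s)
    (ht : 0 < t) (α' β' s' t' δ' : ℝ) :
    defect w u v s t α' β' s' t' δ' = 0 ↔
      (5 * w ^ 5 * u ^ 2 - (s ^ 2 + t ^ 2) * v ^ 2) * α' + 4 * u * v * (s * s' + t * t') = 0 ∧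
        t * s' - s * t' = 0 ∧ β' = 0 ∧ δ' = 0 := by
  constructor
  · intro h
    have h' := (mul_eq_zero.1 h).resolve_left (by positivity)
    set x := (5 * w ^ 5 * u ^ 2 - (s ^ 2 + t ^ 2) * v ^ 2) * α' + 4 * u * v * (s * s' + t * t')
    set y := t * s' - s * t'
    have hx : 0 ≤ (s ^ 2 + t ^ 2) * x ^ 2 := by positivity
    have hy : 0 ≤ 4 * u ^ 2 * (5 * w ^ 5 * u ^ 2 + (s ^ 2 + t ^ 2) * v ^ 2) * y ^ 2 := by positivity
    have hβ : 0 ≤ (s ^ 2 + t ^ 2) * v ^ 2 *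
      (5 * w ^ 5 * u ^ 2 + (s ^ 2 + t ^ 2) * v ^ 2) ^ 2 * β' ^ 2 := by positivity
    have hδ : 0 ≤ 4 * u ^ 2 * s ^ 2 * t ^ 2 * (5 * w ^ 5 * u ^ 2 + (s ^ 2 + t ^ 2) * v ^ 2) *
      δ' ^ 2 := by positivity
    have z {k z : ℝ} (hk : 0 < k) (hz : k * z ^ 2 = 0) : z = 0 := by
      simpa [hk.ne'] using hz
    exact ⟨z (k := s ^ 2 + t ^ 2) (by positivity) (by linarith),
      z (k := 4 * u ^ 2 * (5 * w ^ 5 * u ^ 2 + (s ^ 2 + t ^ 2) * v ^ 2)) (by positivity)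
        (by linarith),
      z (k := (s ^ 2 + t ^ 2) * v ^ 2 * (5 * w ^ 5 * u ^ 2 + (s ^ 2 + t ^ 2) * v ^ 2) ^ 2)
        (by positivity) (by linarith),
      z (k := 4 * u ^ 2 * s ^ 2 * t ^ 2 * (5 * w ^ 5 * u ^ 2 + (s ^ 2 + t ^ 2) * v ^ 2))
        (by positivity) (by linarith)⟩
  · rintro ⟨h₁, h₂, rfl, rfl⟩
    simp [defect, h₁, h₂]

/-- The seven equations reduce to `δ' = 0`, `β' = 0` and one equation each for the part
`t s' - s t'` and the part `s s' + t t'` of the fibre velocity. The last two of the seven are then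
redundant, and the fourth and fifth combine into one. -/
theorem cayleyEquations_iff {c w x s t : ℝ} (hw : w ^ 5 = c + (s ^ 2 + t ^ 2)) (hu : 0 < cos x)
    (hv : 0 < sin x) (hs : 0 < s) (ht : 0 < t) (α' β' s' t' δ' : ℝ) :
    CayleyEquations c x s t α' β' s' t' δ' ↔
      (5 * w ^ 5 * cos x ^ 2 - (s ^ 2 + t ^ 2) * sin x ^ 2) * α' +
          4 * cos x * sin x * (s * s' + t * t') = 0 ∧
        t * s' - s * t' = 0 ∧ β' = 0 ∧ δ' = 0 := by
  unfold CayleyEquations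
  rw [← hw]
  generalize cos x = u at *
  generalize sin x = v at *
  have hr : 0 < s ^ 2 + t ^ 2 := by positivity
  constructor
  · rintro ⟨e₁, e₂, e₃, e₄, e₅, -, -⟩
    refine ⟨?_, ?_, ?_, ?_⟩
    · -- The fifth equation times `t` minus the fourth times `s` is `r²` times this one.
      refine (mul_eq_zero.1 (?_ : (s ^ 2 + t ^ 2) * _ = 0)).resolve_left hr.ne'
      linear_combination t * e₅ - s * e₄
    · exact (mul_eq_zero.1 e₂).resolve_left (by positivity)
    · exact (mul_eq_zero.1 e₁).resolve_left (by positivity)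
    · exact (mul_eq_zero.1 e₃).resolve_left (by positivity)
  · rintro ⟨h₁, h₂, rfl, rfl⟩
    refine ⟨by ring, by rw [h₂, mul_zero], by ring, ?_, ?_, by ring, by ring⟩
    · linear_combination -s * h₁ - 2 * v * u * t * h₂
    · linear_combination t * h₁ - 2 * v * u * s * h₂

/-- If the defect vanishes on a nonzero velocity of the curve, `Φ_c` does not. Here `β'` and `δ'`
are left out: they vanish with the defect and do not enter `Φ_c`. -/
theorem phiValue_ne_zero {w u v s t : ℝ} (hw : 0 < w) (hu : 0 < u) (hv : 0 < v) (hs : 0 < s)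
    (ht : 0 < t) {α' s' t' : ℝ}
    (h₁ : (5 * w ^ 5 * u ^ 2 - (s ^ 2 + t ^ 2) * v ^ 2) * α' + 4 * u * v * (s * s' + t * t') = 0)
    (h₂ : t * s' - s * t' = 0) (h : ¬ (α' = 0 ∧ s' = 0 ∧ t' = 0)) :
    phiValue w u v s t α' s' t' ≠ 0 := by
  intro h₃
  have h₄ := (div_eq_zero_iff.1 h₃).resolve_right (by positivity)
  set X := 5 * w ^ 5 * u ^ 2 - (s ^ 2 + t ^ 2) * v ^ 2
  -- Eliminating `α'`: the two linear equations in `(α', s s' + t t')` have nonzero determinant.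
  have hρ : s * s' + t * t' = 0 := by
    refine (mul_eq_zero.1 (?_ : (2 * X ^ 2 + 40 * w ^ 5 * (s ^ 2 + t ^ 2) * u ^ 2 * v ^ 2) *
      _ = 0)).resolve_left (by positivity)
    linear_combination X * h₄ + 10 * w ^ 5 * (s ^ 2 + t ^ 2) * u * v * h₁
  have hα : α' = 0 := by
    refine (mul_eq_zero.1 (?_ : (10 * w ^ 5 * (s ^ 2 + t ^ 2) * u * v) * _ = 0)).resolve_left
      (by positivity)
    linear_combination 2 * X * hρ - h₄
  have hr : s ^ 2 + t ^ 2 ≠ 0 := by positivity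
  refine h ⟨hα, ?_, ?_⟩
  · refine (mul_eq_zero.1 (?_ : (s ^ 2 + t ^ 2) * _ = 0)).resolve_left hr
    linear_combination s * hρ + t * h₂
  · refine (mul_eq_zero.1 (?_ : (s ^ 2 + t ^ 2) * _ = 0)).resolve_left hr
    linear_combination t * hρ - s * h₂

/-! ### The swept-out 4-fold -/

theorem cr_sweep (c : ℝ) (α β s t δ : ℝ → ℝ) (p : Fin 4 → ℝ) :
    cr c (sweep α β s t δ p) = c + (s (p 0) ^ 2 + t (p 0) ^ 2) := by
  simp only [cr, sweep, Fin.sum_univ_four, Matrix.cons_val]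
  linear_combination s (p 0) ^ 2 * sin_sq_add_cos_sq ((δ (p 0) - p 1) / 2) +
    t (p 0) ^ 2 * sin_sq_add_cos_sq ((δ (p 0) + p 1) / 2)

theorem Phi_tangent_sweep {c : ℝ} {α β s t δ : ℝ → ℝ} {p : Fin 4 → ℝ}
    (hc : 0 ≤ c)
    (hα : DifferentiableAt ℝ α (p 0)) (hβ : DifferentiableAt ℝ β (p 0))
    (hs : DifferentiableAt ℝ s (p 0)) (ht : DifferentiableAt ℝ t (p 0))
    (hδ : DifferentiableAt ℝ δ (p 0)) (hs₀ : 0 < s (p 0)) (hθ : 0 < sin (p 2)) :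
    Phi c (sweep α β s t δ p) (tangent (sweep α β s t δ) p) =
      sin (p 2) * phiValue ((c + (s (p 0) ^ 2 + t (p 0) ^ 2)) ^ (1 / 5 : ℝ)) (cos (α (p 0)))
        (sin (α (p 0))) (s (p 0)) (t (p 0)) (deriv α (p 0)) (deriv s (p 0)) (deriv t (p 0)) := by
  have hx : 0 < c + (s (p 0) ^ 2 + t (p 0) ^ 2) := by positivity
  have h := Phi_frame (c := c) (sin_sq_add_cos_sq _) (sin_sq_add_cos_sq _)
    (b_frame hα hβ hs ht hδ hθ.ne') (xi_frame hα hβ hs ht hδ hθ.ne')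
  rw [map_linearCombination_eq_det_mul, det_frameChange, inv_mul_eq_iff_eq_mul₀ hθ.ne',
    cr_sweep] at h
  have h₄ := rpow_neg_div_five hx 4
  push_cast at h₄
  have hw := rpow_pos_of_pos hx (1 / 5)
  rw [h, h₄, phiValue]
  congr 1
  field_simp
  ring

theorem det_gram_tangent_sweep {c : ℝ} {α β s t δ : ℝ → ℝ} {p : Fin 4 → ℝ}
    (hc : 0 ≤ c)
    (hα : DifferentiableAt ℝ α (p 0)) (hβ : DifferentiableAt ℝ β (p 0))
    (hs : DifferentiableAt ℝ s (p 0)) (ht : DifferentiableAt ℝ t (p 0))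
    (hδ : DifferentiableAt ℝ δ (p 0)) (hs₀ : 0 < s (p 0)) (hθ : 0 < sin (p 2)) :
    (gram c (sweep α β s t δ p) (tangent (sweep α β s t δ) p)).det =
      sin (p 2) ^ 2 *
        (phiValue ((c + (s (p 0) ^ 2 + t (p 0) ^ 2)) ^ (1 / 5 : ℝ)) (cos (α (p 0)))
          (sin (α (p 0))) (s (p 0)) (t (p 0)) (deriv α (p 0)) (deriv s (p 0))
          (deriv t (p 0)) ^ 2 +
        defect ((c + (s (p 0) ^ 2 + t (p 0) ^ 2)) ^ (1 / 5 : ℝ)) (cos (α (p 0)))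
          (sin (α (p 0))) (s (p 0)) (t (p 0)) (deriv α (p 0)) (deriv β (p 0)) (deriv s (p 0))
          (deriv t (p 0)) (deriv δ (p 0))) := by
  have hx : 0 < c + (s (p 0) ^ 2 + t (p 0) ^ 2) := by positivity
  have h₂ := rpow_neg_div_five hx 2
  have h₃ := rpow_div_five hx 3
  push_cast at h₂ h₃
  have h := det_gram_linearCombination c (sweep α β s t δ p)
    (frameChange (cos (α (p 0)) * deriv β (p 0)) (p 1) (p 2)) (tangent (sweep α β s t δ) p)
  rw [gram_frame (sin_sq_add_cos_sq _) (sin_sq_add_cos_sq _)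
    (b_frame hα hβ hs ht hδ hθ.ne') (xi_frame hα hβ hs ht hδ hθ.ne') rfl rfl,
    det_gram_eq_phiValue_sq_add_defect (rpow_pos_of_pos hx (1 / 5)) _ _ _ _ _ _ _ _ _
      (by rw [cr_sweep, h₂]; exact (div_eq_mul_inv _ _).symm) (by rw [cr_sweep, h₃]),
    det_frameChange] at h
  rw [h]
  field_simp

end BryantSalamon

open BryantSalamon in
theorem mainTheorem5 (c : ℝ) (hc : 0 ≤ c) (ε : ℝ) (hε : 0 < ε) (α β s t δ : ℝ → ℝ)
    (hα : ContDiffOn ℝ 1 α (Ioo (-ε) ε)) (hβ : ContDiffOn ℝ 1 β (Ioo (-ε) ε))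
    (hs : ContDiffOn ℝ 1 s (Ioo (-ε) ε)) (ht : ContDiffOn ℝ 1 t (Ioo (-ε) ε))
    (hδ : ContDiffOn ℝ 1 δ (Ioo (-ε) ε))
    (hchart : ∀ τ ∈ Ioo (-ε) ε, α τ ∈ Ioo 0 (π / 2) ∧ 0 < s τ ∧ 0 < t τ)
    (hregular : ∀ τ ∈ Ioo (-ε) ε, ¬ (deriv α τ = 0 ∧ deriv β τ = 0 ∧ deriv s τ = 0 ∧
      deriv t τ = 0 ∧ deriv δ τ = 0)) :
    BryantSalamon.IsCayley c (BryantSalamon.sweep α β s t δ) (BryantSalamon.sweepDomain ε) ↔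
      ∀ τ ∈ Ioo (-ε) ε, BryantSalamon.CayleyEquations c (α τ) (s τ) (t τ)
        (deriv α τ) (deriv β τ) (deriv s τ) (deriv t τ) (deriv δ τ) := by
  have hd {f : ℝ → ℝ} (hf : ContDiffOn ℝ 1 f (Ioo (-ε) ε)) {τ : ℝ} (hτ : τ ∈ Ioo (-ε) ε) :
      DifferentiableAt ℝ f τ :=
    (hf.differentiableOn one_ne_zero).differentiableAt (isOpen_Ioo.mem_nhds hτ)
  have hcont {f : ℝ → ℝ} (hf : ContDiffOn ℝ 1 f (Ioo (-ε) ε)) :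
      ContinuousOn (deriv f) (Ioo (-ε) ε) :=
    hf.continuousOn_deriv_of_isOpen isOpen_Ioo le_rfl
  set w : ℝ → ℝ := fun τ => (c + (s τ ^ 2 + t τ ^ 2)) ^ (1 / 5 : ℝ) with hw_def
  have hcr {τ : ℝ} (hτ : τ ∈ Ioo (-ε) ε) : 0 < c + (s τ ^ 2 + t τ ^ 2) := by
    have := (hchart τ hτ).2.1
    positivity
  have hw {τ : ℝ} (hτ : τ ∈ Ioo (-ε) ε) : 0 < w τ := rpow_pos_of_pos (hcr hτ) _
  have hw₅ {τ : ℝ} (hτ : τ ∈ Ioo (-ε) ε) : w τ ^ 5 = c + (s τ ^ 2 + t τ ^ 2) := by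
    have h := rpow_div_five (hcr hτ) 5
    norm_num at h
    simpa [hw_def] using h.symm
  have hu {τ : ℝ} (hτ : τ ∈ Ioo (-ε) ε) : 0 < cos (α τ) :=
    cos_pos_of_mem_Ioo ⟨by linarith [(hchart τ hτ).1.1, pi_pos], (hchart τ hτ).1.2⟩
  have hv {τ : ℝ} (hτ : τ ∈ Ioo (-ε) ε) : 0 < sin (α τ) :=
    sin_pos_of_pos_of_lt_pi (hchart τ hτ).1.1 (by linarith [(hchart τ hτ).1.2, pi_pos])
  set φ : ℝ → ℝ := fun τ => phiValue (w τ) (cos (α τ)) (sin (α τ)) (s τ) (t τ) (deriv α τ)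
    (deriv s τ) (deriv t τ) with hφ_def
  set d : ℝ → ℝ := fun τ => defect (w τ) (cos (α τ)) (sin (α τ)) (s τ) (t τ) (deriv α τ)
    (deriv β τ) (deriv s τ) (deriv t τ) (deriv δ τ) with hd_def
  have hdefect {τ : ℝ} (hτ : τ ∈ Ioo (-ε) ε) := defect_eq_zero_iff (hw hτ) (hu hτ) (hv hτ)
    (hchart τ hτ).2.1 (hchart τ hτ).2.2 (deriv α τ) (deriv β τ) (deriv s τ) (deriv t τ) (deriv δ τ)
  have heq {τ : ℝ} (hτ : τ ∈ Ioo (-ε) ε) : CayleyEquations c (α τ) (s τ) (t τ) (deriv α τ)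
      (deriv β τ) (deriv s τ) (deriv t τ) (deriv δ τ) ↔ d τ = 0 :=
    (cayleyEquations_iff (hw₅ hτ) (hu hτ) (hv hτ) (hchart τ hτ).2.1 (hchart τ hτ).2.2 _ _ _ _
      _).trans (hdefect hτ).symm
  have hPhi {p : Fin 4 → ℝ} (hp : p ∈ sweepDomain ε) :
      Phi c (sweep α β s t δ p) (tangent (sweep α β s t δ) p) = sin (p 2) * φ (p 0) :=
    Phi_tangent_sweep hc (hd hα hp.1) (hd hβ hp.1) (hd hs hp.1) (hd ht hp.1) (hd hδ hp.1)
      (hchart _ hp.1).2.1 (sin_pos_of_mem_Ioo hp.2)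
  have hvol {p : Fin 4 → ℝ} (hp : p ∈ sweepDomain ε) :
      BryantSalamon.volume c (sweep α β s t δ) p = sin (p 2) * √(φ (p 0) ^ 2 + d (p 0)) := by
    have hθ := sin_pos_of_mem_Ioo hp.2
    have h := det_gram_tangent_sweep hc (hd hα hp.1) (hd hβ hp.1) (hd hs hp.1) (hd ht hp.1)
      (hd hδ hp.1) (hchart _ hp.1).2.1 hθ
    change √(gram c (sweep α β s t δ p) (tangent (sweep α β s t δ) p)).det = _
    rw [h, sqrt_mul (sq_nonneg _), sqrt_sq hθ.le]
  have hd_nonneg {τ : ℝ} (hτ : τ ∈ Ioo (-ε) ε) : 0 ≤ d τ := by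
    have := hw hτ
    simp only [hd_def, defect]
    positivity
  constructor
  -- Squaring removes the sign; one point on each orbit suffices.
  · rintro ⟨-, sign, hsign, h⟩ τ hτ
    have hp : ![τ, 0, π / 2, 0] ∈ sweepDomain ε :=
      ⟨hτ, by simp [pi_pos]⟩
    have h' := h _ hp
    rw [hPhi hp, hvol hp] at h'
    simp only [Fin.isValue, Matrix.cons_val, sin_pi_div_two, one_mul] at h'
    have hsq : sign ^ 2 = 1 := by rcases hsign with rfl | rfl <;> norm_num
    have h'' := congrArg (· ^ 2) h'
    simp only [mul_pow, hsq, one_mul] at h''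
    rw [sq_sqrt (add_nonneg (sq_nonneg _) (hd_nonneg hτ))] at h''
    exact (heq hτ).2 (by linarith)
  · intro h
    have hd₀ {τ : ℝ} (hτ : τ ∈ Ioo (-ε) ε) : d τ = 0 := (heq hτ).1 (h τ hτ)
    have hφ₀ {τ : ℝ} (hτ : τ ∈ Ioo (-ε) ε) : φ τ ≠ 0 := by
      obtain ⟨h₁, h₂, h₃, h₄⟩ := (hdefect hτ).1 (hd₀ hτ)
      exact phiValue_ne_zero (hw hτ) (hu hτ) (hv hτ) (hchart τ hτ).2.1 (hchart τ hτ).2.2 h₁ h₂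
        fun ⟨h₅, h₆, h₇⟩ => hregular τ hτ ⟨h₅, h₃, h₆, h₇, h₄⟩
    have hφ_cont : ContinuousOn φ (Ioo (-ε) ε) := by
      have c₁ := hα.continuousOn
      have c₂ := hs.continuousOn
      have c₃ := ht.continuousOn
      have c₄ := hcont hα
      have c₅ := hcont hs
      have c₆ := hcont ht
      have c₇ : ContinuousOn w (Ioo (-ε) ε) :=
        ContinuousOn.rpow_const (by fun_prop) fun _ _ => Or.inr (by norm_num)
      simp only [hφ_def, phiValue]
      exact ContinuousOn.div (by fun_prop) (by fun_prop) fun τ hτ => (pow_pos (hw hτ) 4).ne'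
    -- `φ` has no zero on the interval, so the sign of `Φ_c` does not change.
    have hsign : ∃ sign : ℝ, (sign = 1 ∨ sign = -1) ∧
        ∀ τ ∈ Ioo (-ε) ε, φ τ = sign * |φ τ| := by
      have h0 : (0 : ℝ) ∈ Ioo (-ε) ε := by simp [hε]
      rcases lt_or_gt_of_ne (hφ₀ h0) with hneg | hpos
      · refine ⟨-1, Or.inr rfl, fun τ hτ => ?_⟩
        have : φ τ < 0 := by
          by_contra! hcon
          obtain ⟨x, hx, hx'⟩ :=
            isPreconnected_Ioo.intermediate_value h0 hτ hφ_cont ⟨hneg.le, hcon⟩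
          exact hφ₀ hx hx'
        rw [abs_of_neg this]
        ring
      · refine ⟨1, Or.inl rfl, fun τ hτ => ?_⟩
        have : 0 < φ τ := by
          by_contra! hcon
          obtain ⟨x, hx, hx'⟩ :=
            isPreconnected_Ioo.intermediate_value hτ h0 hφ_cont ⟨hcon, hpos.le⟩
          exact hφ₀ hx hx'
        rw [abs_of_pos this, one_mul]
    refine ⟨fun p hp => ?_, ?_⟩
    -- `Φ_c` does not vanish on the tangent vectors, so they are independent.
    · by_contra hdep
      have h0 := (Phi c (sweep α β s t δ p)).map_linearDependent _ hdep
      rw [hPhi hp] at h0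
      exact mul_ne_zero (sin_pos_of_mem_Ioo hp.2).ne' (hφ₀ hp.1) h0
    · obtain ⟨sign, h₁, h₂⟩ := hsign
      refine ⟨sign, h₁, fun p hp => ?_⟩
      rw [hPhi hp, hvol hp, hd₀ hp.1, add_zero, sqrt_sq_eq_abs, mul_left_comm, ← h₂ _ hp.1]
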